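/- Let $n\ge 2$, let $\sigma$ be the normalized surface measure on the unit sphere $\mathbb S^{n-1}\subset\mathbb R^n$ (so $\sigma(\mathbb S^{n-1})=1$), let $e_n=(0,\dots,0,1)$, and for $|x|<1$, $\zeta\in\mathbb S^{n-1}$ let $$P_h(x,\zeta)=\left(\frac{1-|x|^2}{|x-\zeta|^2}\right)^{n-1},\qquad P_h[\phi](x)=\int_{\mathbb S^{n-1}}P_h(x,\zeta)\,\phi(\zeta)\,d\sigma(\zeta)$$ for $\phi\in L^1(\mathbb S^{n-1},\mathbb R^n)$. Let $p\in(1,\infty)$, $q=p/(p-1)$, and for $r\in[0,1)$ let $$G_p(r)=\inf_{a\in[0,\infty)}\left(\int_{\mathbb S^{n-1}}|P_h(re_n,\eta)-a|^q\,d\sigma(\eta)\right)^{1/q}.$$ Then $G_p:[0,1)\to[0,\infty)$ is (one-sidedly) differentiable at $r=0$, with $$G_p'(0)=2(n-1)\,\alpha_q^{1/q},\qquad \alpha_q=\frac{\Gamma\left(\frac n2\right)\Gamma\left(\frac{1+q}2\right)}{\sqrt\pi\,\Gamma\left(\frac{n+q}2\right)}.$$ Moreover, this number is the sharp constant in the derivative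 bound: whenever $\phi\in L^p(\mathbb S^{n-1},\mathbb R^n)$ and $u=P_h[\phi]$ satisfies $u(0)=0$, the mapping $u$ is differentiable at $0$ and $\|Du(0)\|\le 2(n-1)\alpha_q^{1/q}\|\phi\|_{L^p}$ (operator norm with respect to the Euclidean norm, $\|\phi\|_{L^p}$ taken with respect to $\sigma$), and $2(n-1)\alpha_q^{1/q}$ is the smallest constant for which this inequality holds for all such $\phi$. -/

import Mathlib

open MeasureTheory

noncomputable section

namespace HypHarm

/-- The Euclidean space `ℝⁿ`. -/
abbrev E (n : ℕ) : Type := EuclideanSpace ℝ (Fin n)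

/-- The unit sphere `S^{n-1}` of `ℝⁿ`. -/
abbrev S (n : ℕ) : Type := Metric.sphere (0 : E n) 1

/-- The normalized surface measure on `S^{n-1}` (total mass `1` for `n ≥ 1`). -/
def sigma (n : ℕ) : Measure (S n) :=
  ((volume : Measure (E n)).toSphere Set.univ)⁻¹ • (volume : Measure (E n)).toSphere

/-- The last standard basis vector `eₙ = (0, …, 0, 1)` of `ℝⁿ`. -/
def lastVec (n : ℕ) : E n :=
  WithLp.toLp 2 fun i => if (i : ℕ) + 1 = n then 1 else 0

/-- The Poisson–Szegő kernel `P_h(x, ζ) = ((1 - |x|²) / |x - ζ|²)^{n-1}`. -/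
def kernel (n : ℕ) (x : E n) (ζ : S n) : ℝ :=
  ((1 - ‖x‖ ^ 2) / ‖x - (ζ : E n)‖ ^ 2) ^ (n - 1)

/-- The invariant Poisson integral `P_h[φ](x) = ∫ P_h(x, ζ) φ(ζ) dσ(ζ)`. -/
def poisson (n : ℕ) (φ : S n → E n) (x : E n) : E n :=
  ∫ ζ, kernel n x ζ • φ ζ ∂(sigma n)

/-- The extremal function `G_p`, for `1 < p < ∞` and with `q = p / (p - 1)`:
`G_p(r) = inf_{a ≥ 0} (∫ |P_h(r eₙ, η) - a|^q dσ(η))^{1/q}`. -/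
def G (n : ℕ) (p r : ℝ) : ℝ :=
  ⨅ a : Set.Ici (0 : ℝ),
    (∫ η, |kernel n (r • lastVec n) η - (a : ℝ)| ^ p.conjExponent ∂(sigma n)) ^
      (1 / p.conjExponent)

/-- `α_q = Γ(n/2) Γ((1+q)/2) / (√π Γ((n+q)/2))`. -/
def alpha (n : ℕ) (q : ℝ) : ℝ :=
  Real.Gamma ((n : ℝ) / 2) * Real.Gamma ((1 + q) / 2) /
    (√Real.pi * Real.Gamma (((n : ℝ) + q) / 2))

/-- The constants `C` admissible in the derivative bound: for all `φ ∈ L^p(S^{n-1}, ℝⁿ)` such that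
`u = P_h[φ]` vanishes at `0`, `u` is differentiable at `0` and `‖Du(0)‖ ≤ C ‖φ‖_{L^p}`
(operator norm with respect to the Euclidean norm). -/
def derivBounds (n : ℕ) (p : ℝ) : Set ℝ :=
  {C | ∀ φ : Lp (E n) (ENNReal.ofReal p) (sigma n), poisson n φ 0 = 0 →
    DifferentiableAt ℝ (poisson n φ) 0 ∧ ‖fderiv ℝ (poisson n φ) 0‖ ≤ C * ‖φ‖}

end HypHarm

end

/-! Uniformly in `ζ`, the kernel is `1 + 2(n-1)⟨x, ζ⟩ + O(‖x‖²)` near the origin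
(`exists_abs_kernel_sub_le`); both claims concern this linear term. Up to `O(r²)`, `G n p r` is the
`L^q` distance from the odd function `2(n-1) r ⟨eₙ, ζ⟩` to the constants `a - 1`. By antipodal
symmetry the best constant is `0`, attained at `a = 1` (`lpNorm_le_lpNorm_add_const_of_odd`), so the
slope is `2(n-1)` times the `L^q` norm of `⟨eₙ, ·⟩`, a moment computed in
`integral_sigma_abs_inner_rpow`. Likewise `Du(0)x = 2(n-1) ∫ ⟨x, ζ⟩ φ(ζ) dσ`. Hölder's inequality
bounds it by the same constant, and its equality case gives sharpness (`le_of_mem_derivBounds`). -/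

namespace HypHarm

/-! ### Moments of linear functionals on the sphere, via Gaussian integrals. -/

/-- Integration in polar coordinates of a function that splits into an angular and a radial
factor. -/
lemma integral_eq_integral_toSphere_mul {V : Type*} [NormedAddCommGroup V] [NormedSpace ℝ V]
    [MeasurableSpace V] [BorelSpace V] [FiniteDimensional ℝ V] [Nontrivial V]
    (μ : Measure V) [μ.IsAddHaarMeasure]
    (F : V → ℝ) (f : Metric.sphere (0 : V) 1 → ℝ) (k : ℝ → ℝ)
    (h : ∀ (ζ : Metric.sphere (0 : V) 1) (r : ℝ), 0 < r → F (r • (ζ : V)) = f ζ * k r) :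
    ∫ x, F x ∂μ = (∫ ζ, f ζ ∂μ.toSphere) *
      ∫ y in Set.Ioi (0 : ℝ), y ^ (Module.finrank ℝ V - 1) * k y := by
  calc
    ∫ x, F x ∂μ = ∫ x : ({(0)}ᶜ : Set V), F x ∂(μ.comap (↑)) := by
      rw [integral_subtype_comap (measurableSet_singleton _).compl fun x ↦ F x,
        restrict_compl_singleton]
    _ = ∫ x, f x.1 * k x.2 ∂μ.toSphere.prod (.volumeIoiPow (Module.finrank ℝ V - 1)) := by
      rw [← μ.measurePreserving_homeomorphUnitSphereProd.integral_comp
        (Homeomorph.measurableEmbedding _)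
        (fun x : Metric.sphere (0 : V) 1 × Set.Ioi (0 : ℝ) ↦ f x.1 * k x.2)]
      refine integral_congr_ae (.of_forall fun x ↦ ?_)
      have hx : 0 < ‖(x : V)‖ := norm_pos_iff.2 x.2
      beta_reduce
      rw [homeomorphUnitSphereProd_apply_snd_coe, ← h _ _ hx,
        homeomorphUnitSphereProd_apply_fst_coe, smul_smul, mul_inv_cancel₀ hx.ne', one_smul]
    _ = (∫ ζ, f ζ ∂μ.toSphere) *
        ∫ x : Set.Ioi (0 : ℝ), k x ∂.volumeIoiPow (Module.finrank ℝ V - 1) :=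
      integral_prod_mul f (fun x : Set.Ioi (0 : ℝ) ↦ k x)
    _ = _ := by
      congr 1
      simp only [Measure.volumeIoiPow, ENNReal.ofReal]
      rw [integral_withDensity_eq_integral_smul,
        integral_subtype_comap measurableSet_Ioi
          fun a ↦ Real.toNNReal (a ^ (Module.finrank ℝ V - 1)) • k a,
        setIntegral_congr_fun measurableSet_Ioi fun x hx ↦ ?_]
      · rw [NNReal.smul_def, Real.coe_toNNReal _ (pow_nonneg hx.out.le _), smul_eq_mul]
      · exact (measurable_subtype_coe.pow_const _).real_toNNReal

lemma integral_abs_rpow_mul_exp_neg_sq {q : ℝ} (hq : -1 < q) :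
    ∫ x : ℝ, |x| ^ q * Real.exp (-x ^ 2) = Real.Gamma ((q + 1) / 2) := by
  have h1 := integral_comp_abs (f := fun x : ℝ ↦ x ^ q * Real.exp (-x ^ 2))
  have h2 := integral_rpow_mul_exp_neg_rpow (p := 2) two_pos hq
  simp only [Real.rpow_two, sq_abs] at h1 h2
  rw [h1, h2]
  ring

/-- In an orthonormal basis containing `h` the integrand is a product over coordinates: the `h`
factor gives the Gamma value, each of the other `n - 1` gives `√π`. -/
lemma integral_abs_inner_rpow_mul_exp_neg_norm_sq {n : ℕ} {q : ℝ} (hq : -1 < q)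
    (h : E n) (hh : ‖h‖ = 1) :
    ∫ x : E n, |inner ℝ h x| ^ q * Real.exp (-‖x‖ ^ 2) =
      Real.Gamma ((q + 1) / 2) * √Real.pi ^ (n - 1) := by
  have hn : 0 < n := by
    rcases Nat.eq_zero_or_pos n with rfl | hn
    · simp [Subsingleton.elim h 0] at hh
    · exact hn
  let i₀ : Fin n := ⟨0, hn⟩
  obtain ⟨b, hb⟩ := Orthonormal.exists_orthonormalBasis_extension_of_card_eq (𝕜 := ℝ)
    (E := E n) (ι := Fin n) (by simp) (v := fun _ ↦ h) (s := {i₀})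
    (by
      rw [orthonormal_iff_ite]
      rintro ⟨i, hi⟩ ⟨j, hj⟩
      obtain rfl : i = i₀ := hi
      obtain rfl : j = i₀ := hj
      simp [hh])
  have hb0 : b i₀ = h := hb i₀ rfl
  have key : ∀ x : E n, |inner ℝ h x| ^ q * Real.exp (-‖x‖ ^ 2) =
      ∏ i, (if i = i₀ then |b.repr x i| ^ q else 1) * Real.exp (-(b.repr x i) ^ 2) := by
    intro x
    rw [Finset.prod_mul_distrib, Finset.prod_ite_eq' Finset.univ i₀ (fun i ↦ |b.repr x i| ^ q),
      ← Real.exp_sum, if_pos (Finset.mem_univ _), b.repr_apply_apply, hb0,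
      ← b.repr.norm_map x, EuclideanSpace.norm_sq_eq, Finset.sum_neg_distrib]
    simp
  simp_rw [key]
  rw [(b.measurePreserving_repr).integral_comp b.repr.toHomeomorph.measurableEmbedding
    (fun y : E n ↦ ∏ i, (if i = i₀ then |y i| ^ q else 1) * Real.exp (-(y i) ^ 2)),
    (PiLp.volume_preserving_ofLp (Fin n)).integral_comp
      (MeasurableEquiv.toLp 2 (Fin n → ℝ)).symm.measurableEmbedding
    (fun y : Fin n → ℝ ↦ ∏ i, (if i = i₀ then |y i| ^ q else 1) * Real.exp (-(y i) ^ 2)),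
    integral_fintype_prod_volume_eq_prod (E := fun _ : Fin n ↦ ℝ)
      (fun i t ↦ (if i = i₀ then |t| ^ q else 1) * Real.exp (-t ^ 2)),
    ← Finset.mul_prod_erase _ _ (Finset.mem_univ i₀)]
  have h1 : ∀ i ∈ Finset.univ.erase i₀,
      ∫ t : ℝ, (if i = i₀ then |t| ^ q else 1) * Real.exp (-t ^ 2) = √Real.pi := fun i hi ↦ by
    simpa [Finset.ne_of_mem_erase hi] using integral_gaussian 1
  rw [Finset.prod_congr rfl h1]
  simp [integral_abs_rpow_mul_exp_neg_sq hq]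

lemma integral_toSphere_abs_inner_rpow {n : ℕ} {q : ℝ} (hq : 0 ≤ q)
    (h : E n) (hh : ‖h‖ = 1) :
    (∫ ζ : S n, |inner ℝ h (ζ : E n)| ^ q ∂(volume : Measure (E n)).toSphere) *
      (Real.Gamma ((n + q) / 2) / 2) = Real.Gamma ((q + 1) / 2) * √Real.pi ^ (n - 1) := by
  have : Nontrivial (E n) := ⟨⟨h, 0, by rintro rfl; simp at hh⟩⟩
  have hn : 0 < n := by simpa using Module.finrank_pos (R := ℝ) (M := E n)
  rw [← integral_abs_inner_rpow_mul_exp_neg_norm_sq (by linarith) h hh,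
    integral_eq_integral_toSphere_mul volume _ (fun ζ : S n ↦ |inner ℝ h (ζ : E n)| ^ q)
      (fun r ↦ r ^ q * Real.exp (-r ^ 2))]
  · congr 1
    have h2 := integral_rpow_mul_exp_neg_rpow (p := 2) (q := n - 1 + q) two_pos
      (by have : (1 : ℝ) ≤ n := by exact_mod_cast hn
          linarith)
    rw [show (n - 1 + q + 1 : ℝ) = n + q by ring] at h2
    rw [div_eq_inv_mul, ← one_div, ← h2]
    refine setIntegral_congr_fun measurableSet_Ioi fun x (hx : 0 < x) ↦ ?_
    simp only [finrank_euclideanSpace, Fintype.card_fin]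
    rw [Real.rpow_add hx, ← Nat.cast_pred hn, Real.rpow_natCast, Real.rpow_two, mul_assoc]
  · intro ζ r hr
    have : ‖(ζ : E n)‖ = 1 := by simp
    rw [inner_smul_right, abs_mul, Real.mul_rpow (abs_nonneg _) (abs_nonneg _), norm_smul, this,
      abs_of_pos hr, Real.norm_of_nonneg hr.le]
    ring_nf

lemma norm_lastVec {n : ℕ} (hn : 1 ≤ n) : ‖lastVec n‖ = 1 := by
  have : lastVec n = EuclideanSpace.single ⟨n - 1, by omega⟩ 1 := by
    ext i
    simp only [lastVec, PiLp.single_apply, Fin.ext_iff]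
    congr 1
    simp only [eq_iff_iff]
    omega
  simp [this]

lemma nontrivial_E {n : ℕ} (hn : 1 ≤ n) : Nontrivial (E n) :=
  ⟨⟨lastVec n, 0, fun h ↦ by simpa [h] using norm_lastVec hn⟩⟩

lemma isProbabilityMeasure_sigma {n : ℕ} (hn : 1 ≤ n) : IsProbabilityMeasure (sigma n) := by
  have := nontrivial_E hn
  refine ⟨?_⟩
  rw [sigma, Measure.smul_apply, smul_eq_mul]
  exact ENNReal.inv_mul_cancel (Measure.measure_univ_ne_zero.2
    (Measure.toSphere_ne_zero _)) (measure_ne_top _ _)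

/-- The absolute moments of a linear functional on the sphere. -/
lemma integral_sigma_abs_inner_rpow {n : ℕ} {q : ℝ} (hq : 0 ≤ q)
    (h : E n) (hh : ‖h‖ = 1) :
    ∫ ζ : S n, |inner ℝ h (ζ : E n)| ^ q ∂(sigma n) = alpha n q := by
  have : Nontrivial (E n) := ⟨⟨h, 0, by rintro rfl; simp at hh⟩⟩
  have hn : 0 < n := by simpa using Module.finrank_pos (R := ℝ) (M := E n)
  have hn' : (0 : ℝ) < n := by exact_mod_cast hn
  have h1 := integral_toSphere_abs_inner_rpow hq h hh
  -- Exponent `0` yields the total mass of `toSphere`, the normalizing factor of `sigma`.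
  have h0 := integral_toSphere_abs_inner_rpow le_rfl h hh
  simp only [Real.rpow_zero, integral_const, smul_eq_mul, mul_one, add_zero, zero_add,
    Real.Gamma_one_half_eq] at h0
  have hT : (volume : Measure (E n)).toSphere.real Set.univ ≠ 0 := by
    intro hT
    rw [hT, zero_mul] at h0
    have : 0 < √Real.pi := by positivity
    exact (mul_pos this (pow_pos this _)).ne h0
  have hG : 0 < Real.Gamma ((n + q) / 2) := Real.Gamma_pos_of_pos (by positivity)
  have hpi : 0 < √Real.pi := by positivity
  rw [sigma, integral_smul_measure, alpha, ENNReal.toReal_inv, smul_eq_mul]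
  change ((volume : Measure (E n)).toSphere.real Set.univ)⁻¹ * _ = _
  rw [inv_mul_eq_div, div_eq_div_iff hT (by positivity)]
  generalize ∫ ζ : S n, |inner ℝ h (ζ : E n)| ^ q ∂(volume : Measure (E n)).toSphere = A at h1 ⊢
  rw [add_comm 1 q]
  linear_combination (2 * √Real.pi) * h1 - 2 * Real.Gamma ((q + 1) / 2) * h0

lemma alpha_pos {n : ℕ} {q : ℝ} (hn : 1 ≤ n) (hq : 0 ≤ q) : 0 < alpha n q := by
  have hn' : (0 : ℝ) < n := by exact_mod_cast hn
  have h1 : 0 < Real.Gamma ((n + q) / 2) := Real.Gamma_pos_of_pos (by positivity)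
  have h2 : 0 < Real.Gamma ((1 + q) / 2) := Real.Gamma_pos_of_pos (by positivity)
  have h3 : 0 < Real.Gamma ((n : ℝ) / 2) := Real.Gamma_pos_of_pos (by positivity)
  unfold alpha
  positivity

/-! ### Antipodal symmetry. -/

lemma measurePreserving_neg_sigma (n : ℕ) :
    MeasurePreserving (fun ζ : S n ↦ -ζ) (sigma n) (sigma n) := by
  have hm : Measurable (fun ζ : S n ↦ -ζ) := continuous_neg.measurable
  refine MeasurePreserving.smul_measure ⟨hm, ?_⟩ _
  ext s hs
  rw [Measure.map_apply hm hs, Measure.toSphere_apply' _ hs, Measure.toSphere_apply' _ (hm hs)]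
  congr 1
  -- `toSphere` measures the cone over a set, and the cone over `-s` is the negative of the cone
  -- over `s`.
  rw [← Measure.measure_neg]
  congr 1
  ext x
  simp only [Set.mem_neg, Set.mem_smul, Set.mem_image, Set.mem_preimage]
  constructor
  · rintro ⟨r, hr, _, ⟨ζ, hζ, rfl⟩, h⟩
    exact ⟨r, hr, _, ⟨-ζ, hζ, rfl⟩, by simp [h]⟩
  · rintro ⟨r, hr, _, ⟨ζ, hζ, rfl⟩, h⟩
    exact ⟨r, hr, _, ⟨-ζ, by simpa using hζ, rfl⟩, by simp [h]⟩

/-- Odd functions on the sphere have mean zero. -/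
lemma integral_sigma_eq_zero_of_odd {n : ℕ} {F : Type*}
    [NormedAddCommGroup F] [NormedSpace ℝ F]
    {f : S n → F} (hf : ∀ ζ, f (-ζ) = -f ζ) : ∫ ζ, f ζ ∂(sigma n) = 0 := by
  have h := (measurePreserving_neg_sigma n).integral_comp
    (Homeomorph.neg (S n)).measurableEmbedding f
  simp only [hf, integral_neg] at h
  have h2 : (2 : ℝ) • ∫ ζ, f ζ ∂(sigma n) = 0 := by
    rw [two_smul]
    nth_rewrite 1 [← h]
    exact neg_add_cancel _
  exact (smul_eq_zero.1 h2).resolve_left two_ne_zero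

/-! ### First-order expansion of the kernel. -/

lemma exists_abs_pow_sub_one_sub_le (m : ℕ) :
    ∃ K : ℝ, 0 ≤ K ∧ ∀ b : ℝ, |b| ≤ 9 → |b ^ m - 1 - m * (b - 1)| ≤ K * (b - 1) ^ 2 := by
  induction m with
  | zero => exact ⟨0, le_rfl, by simp⟩
  | succ m ih =>
    obtain ⟨K, hK, h⟩ := ih
    refine ⟨9 * K + m, by positivity, fun b hb ↦ ?_⟩
    calc |b ^ (m + 1) - 1 - ((m + 1 : ℕ) : ℝ) * (b - 1)|
        = |b * (b ^ m - 1 - m * (b - 1)) + m * (b - 1) ^ 2| := by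
          congr 1
          push_cast
          ring
      _ ≤ |b * (b ^ m - 1 - m * (b - 1))| + |m * (b - 1) ^ 2| := abs_add_le _ _
      _ = |b| * |b ^ m - 1 - m * (b - 1)| + m * (b - 1) ^ 2 := by
          rw [abs_mul, abs_of_nonneg (a := m * (b - 1) ^ 2) (by positivity)]
      _ ≤ 9 * (K * (b - 1) ^ 2) + m * (b - 1) ^ 2 := by
          gcongr
          exact h b hb
      _ = _ := by ring

/-- First-order expansion of the kernel at the origin, uniformly on the sphere. -/
lemma exists_abs_kernel_sub_le {n : ℕ} (hn : 1 ≤ n) :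
    ∃ K : ℝ, 0 ≤ K ∧ ∀ (x : E n) (ζ : S n), ‖x‖ ≤ 1 / 2 →
      |kernel n x ζ - 1 - 2 * ((n : ℝ) - 1) * inner ℝ x (ζ : E n)| ≤ K * ‖x‖ ^ 2 := by
  obtain ⟨K, hK, h⟩ := exists_abs_pow_sub_one_sub_le (n - 1)
  rw [Nat.cast_pred hn] at h
  have hn' : (0 : ℝ) ≤ n - 1 := by simpa using hn
  refine ⟨256 * K + 28 * (n - 1), by positivity, fun x ζ hx ↦ ?_⟩
  have hζ : ‖(ζ : E n)‖ = 1 := by simp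
  have ht : |inner ℝ x (ζ : E n)| ≤ ‖x‖ := by simpa [hζ] using abs_real_inner_le_norm x (ζ : E n)
  have hρ := norm_nonneg x
  unfold kernel
  rw [norm_sub_sq_real, hζ]
  generalize inner ℝ x (ζ : E n) = t at *
  generalize ‖x‖ = ρ at *
  have ht' := abs_le.1 ht
  have hts : t ^ 2 ≤ ρ ^ 2 := sq_le_sq' ht'.1 ht'.2
  -- The denominator is at least `(1 - ρ)²`, with `ρ ≤ 1/2`.
  have hD : 1 / 4 ≤ ρ ^ 2 - 2 * t + 1 ^ 2 := by nlinarith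
  have hD0 : 0 < ρ ^ 2 - 2 * t + 1 ^ 2 := by linarith
  obtain ⟨b, hb⟩ : ∃ b, b = (1 - ρ ^ 2) / (ρ ^ 2 - 2 * t + 1 ^ 2) := ⟨_, rfl⟩
  rw [← hb]
  have h1 : |b - 1 - 2 * t| ≤ 28 * ρ ^ 2 := by
    have : b - 1 - 2 * t =
        (4 * t ^ 2 - 2 * ρ ^ 2 - 2 * t * ρ ^ 2) / (ρ ^ 2 - 2 * t + 1 ^ 2) := by
      rw [eq_div_iff hD0.ne', sub_mul, sub_mul, hb, div_mul_cancel₀ _ hD0.ne']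
      ring
    rw [this, abs_div, abs_of_pos hD0, div_le_iff₀ hD0]
    -- The three terms contribute `4 + 2 + 1`; dividing by `1/4` gives `28`.
    have hnum : |4 * t ^ 2 - 2 * ρ ^ 2 - 2 * t * ρ ^ 2| ≤ 7 * ρ ^ 2 := by
      rw [abs_le]
      constructor <;> nlinarith [sq_nonneg ρ, sq_nonneg t]
    nlinarith [sq_nonneg ρ]
  -- `2ρ + 28ρ² ≤ 16ρ` since `ρ ≤ 1/2`; hence `|b| ≤ 1 + 8`, the range allowed in `h`.
  have h2 : |b - 1| ≤ 16 * ρ := by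
    have := abs_le.1 h1
    rw [abs_le]
    constructor <;> nlinarith
  have h3 : |b| ≤ 9 := by
    have := abs_le.1 h2
    rw [abs_le]
    constructor <;> linarith
  have h4 : (b - 1) ^ 2 ≤ 256 * ρ ^ 2 := by
    have := abs_le.1 h2
    nlinarith
  calc |b ^ (n - 1) - 1 - 2 * ((n : ℝ) - 1) * t|
      = |(b ^ (n - 1) - 1 - (n - 1) * (b - 1)) + (n - 1) * (b - 1 - 2 * t)| := by
        congr 1
        ring
    _ ≤ |b ^ (n - 1) - 1 - (n - 1) * (b - 1)| + |(n - 1) * (b - 1 - 2 * t)| := abs_add_le _ _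
    _ ≤ K * (256 * ρ ^ 2) + (n - 1) * (28 * ρ ^ 2) := by
        rw [abs_mul, abs_of_nonneg hn']
        gcongr
        exact (h b h3).trans (by gcongr)
    _ = _ := by ring

/-! ### `L^q` norms on the sphere and the derivative of `G` at `0`. -/

lemma continuous_kernel {n : ℕ} {x : E n} (hx : ‖x‖ < 1) : Continuous (kernel n x) := by
  unfold kernel
  refine (Continuous.div (by fun_prop) (by fun_prop) fun ζ ↦ ?_).pow _
  refine pow_ne_zero 2 (norm_ne_zero_iff.2 (sub_ne_zero.2 ?_))
  rintro rfl
  simp at hx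

lemma memLp_of_continuous {n : ℕ} (hn : 1 ≤ n) {F : Type*} [NormedAddCommGroup F]
    {f : S n → F} (hf : Continuous f) (Q : ENNReal) : MemLp f Q (sigma n) :=
  have := isProbabilityMeasure_sigma hn
  hf.memLp_of_hasCompactSupport (.of_compactSpace f)

/-- Adding a constant to an odd function does not decrease its `L^Q` norm. -/
lemma lpNorm_le_lpNorm_add_const_of_odd {n : ℕ} (hn : 1 ≤ n) {f : S n → ℝ} (hf : Continuous f)
    (hodd : ∀ ζ, f (-ζ) = -f ζ) (d : ℝ) {Q : ENNReal} (hQ : 1 ≤ Q) :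
    lpNorm f Q (sigma n) ≤ lpNorm (fun ζ ↦ f ζ + d) Q (sigma n) := by
  have hc : Continuous fun ζ ↦ f ζ + d := by fun_prop
  have hc' : Continuous fun ζ ↦ f ζ - d := by fun_prop
  -- The antipode turns `f + d` into `-(f - d)`; the triangle inequality for `(f + d) + (f - d) =
  -- 2f` then suffices.
  have h1 : lpNorm (fun ζ ↦ f ζ - d) Q (sigma n) = lpNorm (fun ζ ↦ f ζ + d) Q (sigma n) := by
    have h := eLpNorm_comp_measurePreserving (p := Q) (memLp_of_continuous hn hc Q).1
      (measurePreserving_neg_sigma n)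
    have he : ((fun ζ ↦ f ζ + d) ∘ fun ζ : S n ↦ -ζ) = -fun ζ ↦ f ζ - d := by
      ext ζ
      simp [hodd]
      ring
    rw [he, eLpNorm_neg] at h
    rw [← toReal_eLpNorm (memLp_of_continuous hn hc Q).1,
      ← toReal_eLpNorm (memLp_of_continuous hn hc' Q).1, h]
  have h2 := lpNorm_add_le (memLp_of_continuous hn hc Q) (g := fun ζ ↦ f ζ - d) hQ
  have h3 : ((fun ζ ↦ f ζ + d) + fun ζ ↦ f ζ - d) = (2 : ℝ) • f := by
    ext ζ
    simp
    ring
  rw [h3, lpNorm_const_smul, h1] at h2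
  have : ‖(2 : ℝ)‖₊ = 2 := by simp
  rw [this] at h2
  have h4 : (2 : ℝ) * lpNorm f Q (sigma n) ≤ _ := h2
  linarith

lemma lpNorm_eq_integral {n : ℕ} (hn : 1 ≤ n) {f : S n → ℝ} (hf : Continuous f) {q : ℝ}
    (hq : 0 < q) :
    lpNorm f (ENNReal.ofReal q) (sigma n) = (∫ ζ, |f ζ| ^ q ∂(sigma n)) ^ (1 / q) := by
  rw [lpNorm_eq_integral_norm_rpow_toReal (by simpa using hq) ENNReal.ofReal_ne_top
    (memLp_of_continuous hn hf 0).1, ENNReal.toReal_ofReal hq.le, one_div]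
  rfl

lemma lpNorm_le_of_forall_abs_le {n : ℕ} (hn : 1 ≤ n) {f : S n → ℝ} {c : ℝ} (hc : 0 ≤ c)
    (hf : ∀ ζ, |f ζ| ≤ c) {q : ℝ} (hq : 0 < q) :
    lpNorm f (ENNReal.ofReal q) (sigma n) ≤ c := by
  have := isProbabilityMeasure_sigma hn
  refine (lpNorm_mono_real (memLp_const c) hf).trans_eq ?_
  rw [lpNorm_const' (by simpa using hq) ENNReal.ofReal_ne_top]
  simp [abs_of_nonneg hc]

/-- The extremal function agrees with its linearization at `0` to second order. -/
lemma exists_abs_G_sub_le {n : ℕ} (hn : 1 ≤ n) {p q : ℝ} (hpq : p.HolderConjugate q) :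
    ∃ K : ℝ, 0 ≤ K ∧ ∀ r : ℝ, 0 ≤ r → r ≤ 1 / 2 →
      |G n p r - 2 * ((n : ℝ) - 1) * alpha n q ^ (1 / q) * r| ≤ K * r ^ 2 := by
  obtain ⟨K, hK, h⟩ := exists_abs_kernel_sub_le hn
  have := isProbabilityMeasure_sigma hn
  have hq0 : 0 < q := hpq.symm.pos
  have hQ : 1 ≤ ENNReal.ofReal q := by simpa using hpq.symm.lt.le
  have hn' : (0 : ℝ) ≤ n - 1 := by simpa using hn
  refine ⟨K, hK, fun r hr0 hr ↦ ?_⟩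
  have hx : ‖r • lastVec n‖ = r := by
    rw [norm_smul, norm_lastVec hn, Real.norm_of_nonneg hr0, mul_one]
  set k : S n → ℝ := kernel n (r • lastVec n) with hk
  have hkc : Continuous k := continuous_kernel (by rw [hx]; linarith)
  set f : S n → ℝ := fun ζ ↦ 2 * ((n : ℝ) - 1) * r * inner ℝ (lastVec n) (ζ : E n) with hf
  have hfc : Continuous f := by fun_prop
  have hkf : ∀ ζ, |k ζ - 1 - f ζ| ≤ K * r ^ 2 := fun ζ ↦ by
    have := h (r • lastVec n) ζ (by rwa [hx])
    rwa [hx, real_inner_smul_left, ← mul_assoc] at this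
  have hG : G n p r = ⨅ a : Set.Ici (0 : ℝ),
      lpNorm (fun ζ ↦ k ζ - (a : ℝ)) (ENNReal.ofReal q) (sigma n) := by
    rw [G, hpq.conjExponent_eq]
    exact iInf_congr fun a ↦ (lpNorm_eq_integral hn (hkc.sub continuous_const) hq0).symm
  have hfN : lpNorm f (ENNReal.ofReal q) (sigma n) =
      2 * ((n : ℝ) - 1) * alpha n q ^ (1 / q) * r := by
    have hl : lpNorm (fun ζ : S n ↦ inner ℝ (lastVec n) (ζ : E n)) (ENNReal.ofReal q) (sigma n) =
        alpha n q ^ (1 / q) := by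
      rw [lpNorm_eq_integral hn (by fun_prop) hq0,
        integral_sigma_abs_inner_rpow hq0.le _ (norm_lastVec hn)]
    have hf' : f = (2 * ((n : ℝ) - 1) * r) • fun ζ : S n ↦ inner ℝ (lastVec n) (ζ : E n) := rfl
    rw [hf', lpNorm_const_smul, hl, coe_nnnorm, Real.norm_of_nonneg (by positivity)]
    ring
  have hrem : lpNorm (fun ζ ↦ k ζ - 1 - f ζ) (ENNReal.ofReal q) (sigma n) ≤ K * r ^ 2 :=
    lpNorm_le_of_forall_abs_le hn (by positivity) hkf hq0
  rw [← hfN, abs_le]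
  constructor
  · have : lpNorm f (ENNReal.ofReal q) (sigma n) - K * r ^ 2 ≤ G n p r := by
      rw [hG]
      refine le_ciInf fun a ↦ ?_
      have h1 := lpNorm_le_lpNorm_add_const_of_odd hn hfc (fun ζ ↦ by simp [hf]) (1 - a) hQ
      have h2 := lpNorm_sub_le (memLp_of_continuous hn
        (show Continuous fun ζ ↦ k ζ - (a : ℝ) by fun_prop) (ENNReal.ofReal q))
        (g := fun ζ ↦ k ζ - 1 - f ζ) hQ
      have h3 : ((fun ζ ↦ k ζ - (a : ℝ)) - fun ζ ↦ k ζ - 1 - f ζ) = fun ζ ↦ f ζ + (1 - a) := by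
        ext ζ
        simp only [Pi.sub_apply]
        ring
      rw [h3] at h2
      linarith
    linarith
  · have : G n p r ≤ lpNorm f (ENNReal.ofReal q) (sigma n) + K * r ^ 2 := by
      rw [hG]
      -- `a = 1`, the value of the kernel at the origin, leaves only the linear term and the
      -- remainder.
      refine (ciInf_le ⟨0, ?_⟩ ⟨1, Set.mem_Ici.2 zero_le_one⟩).trans ?_
      · rintro _ ⟨a, rfl⟩
        exact lpNorm_nonneg
      · have h2 := lpNorm_add_le (memLp_of_continuous hn hfc (ENNReal.ofReal q))
          (g := fun ζ ↦ k ζ - 1 - f ζ) hQ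
        have h3 : (f + fun ζ ↦ k ζ - 1 - f ζ) = fun ζ ↦ k ζ - 1 := by
          ext ζ
          simp
        rw [h3] at h2
        linarith
    linarith

lemma hasDerivWithinAt_G {n : ℕ} (hn : 1 ≤ n) {p q : ℝ} (hpq : p.HolderConjugate q) :
    HasDerivWithinAt (G n p) (2 * ((n : ℝ) - 1) * alpha n q ^ (1 / q)) (Set.Ico 0 1) 0 := by
  obtain ⟨K, -, h⟩ := exists_abs_G_sub_le hn hpq
  have h0 : G n p 0 = 0 := by simpa using h 0 le_rfl (by norm_num)
  rw [hasDerivWithinAt_iff_isLittleO]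
  have hO : (fun r : ℝ ↦ r ^ 2) =o[nhdsWithin 0 (Set.Ico 0 1)] fun r : ℝ ↦ r - 0 := by
    simpa using (Asymptotics.isLittleO_pow_id one_lt_two).mono nhdsWithin_le_nhds
  refine (Asymptotics.IsBigO.of_bound K ?_).trans_isLittleO hO
  filter_upwards [self_mem_nhdsWithin,
    nhdsWithin_le_nhds (Iic_mem_nhds (show (0 : ℝ) < 1 / 2 by norm_num))] with r hr hr'
  simp only [h0, sub_zero, smul_eq_mul, Real.norm_eq_abs, abs_pow, sq_abs]
  rw [mul_comm r]
  exact h r hr.1 hr'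

/-! ### The differential of the Poisson integral at the origin and its bound. -/

lemma poisson_zero (n : ℕ) (φ : S n → E n) : poisson n φ 0 = ∫ ζ, φ ζ ∂(sigma n) := by
  simp [poisson, kernel]

lemma integrable_smul_of_continuous {n : ℕ} {F : Type*} [NormedAddCommGroup F] [NormedSpace ℝ F]
    {φ : S n → F} (hφ : Integrable φ (sigma n))
    {f : S n → ℝ} (hf : Continuous f) : Integrable (fun ζ ↦ f ζ • φ ζ) (sigma n) := by
  obtain ⟨C, hC⟩ := isCompact_univ.exists_bound_of_continuousOn hf.continuousOn
  have h : ∀ᵐ ζ ∂(sigma n), ‖f ζ‖ ≤ C := .of_forall fun ζ ↦ hC ζ trivial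
  exact Integrable.bdd_smul (𝕜 := ℝ) (φ := f) hφ C hf.aestronglyMeasurable h

lemma integral_smul_sub_sub_smul {n : ℕ} {F : Type*} [NormedAddCommGroup F] [NormedSpace ℝ F]
    {φ : S n → F} (hφ : Integrable φ (sigma n)) {f g : S n → ℝ} (hf : Continuous f)
    (hg : Continuous g) (c : ℝ) :
    ∫ ζ, f ζ • φ ζ ∂(sigma n) - ∫ ζ, φ ζ ∂(sigma n) - c • ∫ ζ, g ζ • φ ζ ∂(sigma n) =
      ∫ ζ, (f ζ - 1 - c * g ζ) • φ ζ ∂(sigma n) := by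
  have h1 := integrable_smul_of_continuous hφ hf
  have h2 : Integrable (fun ζ ↦ c • g ζ • φ ζ) (sigma n) :=
    (integrable_smul_of_continuous hφ hg).smul c
  simp only [sub_smul, one_smul, mul_smul]
  rw [integral_sub (f := fun ζ ↦ f ζ • φ ζ - φ ζ) (h1.sub hφ) h2, integral_sub h1 hφ, integral_smul]

lemma integrable_inner_smul {n : ℕ} {φ : S n → E n} (hφ : Integrable φ (sigma n)) (x : E n) :
    Integrable (fun ζ : S n ↦ (inner ℝ x (ζ : E n) : ℝ) • φ ζ) (sigma n) :=
  integrable_smul_of_continuous hφ (f := fun ζ ↦ inner ℝ x (ζ : E n)) (by fun_prop)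

/-- The differential at the origin of the invariant Poisson integral of `φ`. -/
noncomputable def poissonDeriv (n : ℕ) (φ : S n → E n) (hφ : Integrable φ (sigma n)) :
    E n →L[ℝ] E n :=
  LinearMap.toContinuousLinearMap
    { toFun := fun x ↦ (2 * ((n : ℝ) - 1)) • ∫ ζ : S n, (inner ℝ x (ζ : E n) : ℝ) • φ ζ ∂(sigma n)
      map_add' := fun x y ↦ by
        simp only [inner_add_left, add_smul]
        rw [integral_add (integrable_inner_smul hφ x) (integrable_inner_smul hφ y), smul_add]
      map_smul' := fun c x ↦ by
        simp only [real_inner_smul_left, mul_smul (c : ℝ) (inner ℝ _ _), RingHom.id_apply]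
        rw [integral_smul]
        exact smul_comm (2 * ((n : ℝ) - 1)) c
          (∫ ζ : S n, (inner ℝ x (ζ : E n) : ℝ) • φ ζ ∂(sigma n)) }

lemma poissonDeriv_apply {n : ℕ} {φ : S n → E n} (hφ : Integrable φ (sigma n)) (x : E n) :
    poissonDeriv n φ hφ x =
      (2 * ((n : ℝ) - 1)) • ∫ ζ : S n, (inner ℝ x (ζ : E n) : ℝ) • φ ζ ∂(sigma n) := rfl

lemma hasFDerivAt_poisson {n : ℕ} (hn : 1 ≤ n) {φ : S n → E n} (hφ : Integrable φ (sigma n)) :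
    HasFDerivAt (poisson n φ) (poissonDeriv n φ hφ) 0 := by
  obtain ⟨K, hK, h⟩ := exists_abs_kernel_sub_le hn
  rw [hasFDerivAt_iff_isLittleO_nhds_zero]
  have hO : (fun x : E n ↦ ‖x‖ ^ 2) =o[nhds 0] fun x ↦ x :=
    Asymptotics.isLittleO_norm_pow_id one_lt_two
  refine (Asymptotics.IsBigO.of_bound (K * ∫ ζ, ‖φ ζ‖ ∂(sigma n)) ?_).trans_isLittleO hO
  filter_upwards [Metric.closedBall_mem_nhds (0 : E n) (show (0 : ℝ) < 1 / 2 by norm_num)]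
    with x hx
  rw [mem_closedBall_zero_iff] at hx
  have hx2 : poisson n φ (0 + x) - poisson n φ 0 - poissonDeriv n φ hφ x =
      ∫ ζ, (kernel n x ζ - 1 - 2 * ((n : ℝ) - 1) * inner ℝ x (ζ : E n)) • φ ζ ∂(sigma n) := by
    rw [zero_add, poisson_zero, poissonDeriv_apply, poisson]
    exact integral_smul_sub_sub_smul hφ (continuous_kernel (by linarith)) (by fun_prop) _
  rw [hx2, norm_pow, norm_norm, mul_right_comm, ← integral_const_mul]
  refine norm_integral_le_of_norm_le (hφ.norm.const_mul _) (.of_forall fun ζ ↦ ?_)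
  rw [norm_smul]
  gcongr
  exact h x ζ hx

lemma Lp_norm_eq_integral {n : ℕ} {p : ℝ} (hp : 0 < p)
    (φ : Lp (E n) (ENNReal.ofReal p) (sigma n)) :
    ‖φ‖ = (∫ ζ, ‖φ ζ‖ ^ p ∂(sigma n)) ^ (1 / p) := by
  rw [Lp.norm_def, toReal_eLpNorm (Lp.aestronglyMeasurable φ),
    lpNorm_eq_integral_norm_rpow_toReal (by simpa using hp) ENNReal.ofReal_ne_top
    (Lp.aestronglyMeasurable φ), ENNReal.toReal_ofReal hp.le, one_div]

lemma integrable_of_Lp {n : ℕ} (hn : 1 ≤ n) {p : ℝ} (hp : 1 ≤ p)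
    (φ : Lp (E n) (ENNReal.ofReal p) (sigma n)) : Integrable φ (sigma n) :=
  have := isProbabilityMeasure_sigma hn
  (Lp.memLp φ).integrable (by simpa using hp)

lemma norm_poissonDeriv_le {n : ℕ} (hn : 1 ≤ n) {p q : ℝ} (hpq : p.HolderConjugate q)
    (φ : Lp (E n) (ENNReal.ofReal p) (sigma n)) (hφ : Integrable φ (sigma n)) :
    ‖poissonDeriv n φ hφ‖ ≤ 2 * ((n : ℝ) - 1) * alpha n q ^ (1 / q) * ‖φ‖ := by
  have hn' : (0 : ℝ) ≤ n - 1 := by simpa using hn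
  have hα := (alpha_pos hn hpq.symm.nonneg).le
  have hc : 0 ≤ 2 * ((n : ℝ) - 1) := by positivity
  refine ContinuousLinearMap.opNorm_le_of_unit_norm
    (mul_nonneg (mul_nonneg hc (Real.rpow_nonneg hα _)) ENNReal.toReal_nonneg) fun x hx ↦ ?_
  rw [poissonDeriv_apply, norm_smul, Real.norm_of_nonneg hc, mul_assoc (2 * ((n : ℝ) - 1))]
  refine mul_le_mul_of_nonneg_left ?_ hc
  calc ‖∫ ζ : S n, (inner ℝ x (ζ : E n) : ℝ) • φ ζ ∂(sigma n)‖
      ≤ ∫ ζ : S n, ‖(inner ℝ x (ζ : E n) : ℝ) • φ ζ‖ ∂(sigma n) := norm_integral_le_integral_norm _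
    _ = ∫ ζ : S n, ‖(inner ℝ x (ζ : E n) : ℝ)‖ * ‖(‖φ ζ‖ : ℝ)‖ ∂(sigma n) := by
        simp only [norm_smul, norm_norm]
    _ ≤ (∫ ζ : S n, ‖(inner ℝ x (ζ : E n) : ℝ)‖ ^ q ∂(sigma n)) ^ (1 / q) *
          (∫ ζ, ‖(‖φ ζ‖ : ℝ)‖ ^ p ∂(sigma n)) ^ (1 / p) :=
        integral_mul_norm_le_Lp_mul_Lq hpq.symm (memLp_of_continuous hn (by fun_prop) _)
          (Lp.memLp φ).norm
    _ = alpha n q ^ (1 / q) * ‖φ‖ := by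
        simp only [norm_norm, Real.norm_eq_abs (inner _ _ _)]
        rw [integral_sigma_abs_inner_rpow hpq.symm.nonneg x hx, ← Lp_norm_eq_integral hpq.pos]

/-! ### Sharpness. -/

/-- The extremal boundary map in the direction `h`. -/
noncomputable def extremal (n : ℕ) (q : ℝ) (h : E n) (ζ : S n) : E n :=
  ((SignType.sign (inner ℝ h (ζ : E n)) : ℝ) * |inner ℝ h (ζ : E n)| ^ (q - 1)) • h

lemma norm_extremal {n : ℕ} {q : ℝ} (hq : 1 < q) {h : E n} (hh : ‖h‖ = 1) (ζ : S n) :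
    ‖extremal n q h ζ‖ = |inner ℝ h (ζ : E n)| ^ (q - 1) := by
  rw [extremal, norm_smul, hh, mul_one, norm_mul, Real.norm_of_nonneg (r := _ ^ _) (by positivity)]
  rcases lt_trichotomy (inner ℝ h (ζ : E n)) 0 with ht | ht | ht
  · simp [sign_neg ht]
  · simp [ht, Real.zero_rpow (sub_pos.2 hq).ne']
  · simp [sign_pos ht]

lemma memLp_extremal {n : ℕ} (hn : 1 ≤ n) {q : ℝ} (hq : 1 < q) {h : E n} (hh : ‖h‖ = 1)
    (Q : ENNReal) : MemLp (extremal n q h) Q (sigma n) := by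
  have := isProbabilityMeasure_sigma hn
  refine MemLp.of_bound ?_ 1 (.of_forall fun ζ ↦ ?_)
  · have hs : Measurable fun t : ℝ ↦ ((SignType.sign t : SignType) : ℝ) := by
      have : (fun t : ℝ ↦ ((SignType.sign t : SignType) : ℝ)) =
          fun t ↦ if 0 < t then 1 else if t < 0 then -1 else 0 := by
        ext t
        rw [sign_apply]
        split_ifs <;> simp
      rw [this]
      exact .ite measurableSet_Ioi measurable_const
        (.ite measurableSet_Iio measurable_const measurable_const)
    have hi : Measurable fun ζ : S n ↦ (inner ℝ h (ζ : E n) : ℝ) :=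
      Continuous.measurable (by fun_prop)
    exact (((hs.comp hi).mul (hi.norm.pow_const (q - 1))).smul_const h).aestronglyMeasurable
  · rw [norm_extremal hq hh]
    refine Real.rpow_le_one (abs_nonneg _) ?_ (sub_pos.2 hq).le
    simpa [hh] using abs_real_inner_le_norm h (ζ : E n)

lemma inner_smul_extremal {n : ℕ} {q : ℝ} (hq : 1 < q) (h : E n) (ζ : S n) :
    inner ℝ h (ζ : E n) • extremal n q h ζ = |inner ℝ h (ζ : E n)| ^ q • h := by
  rw [extremal, smul_smul, ← mul_assoc, mul_comm (inner ℝ h (ζ : E n)), sign_mul_self]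
  congr 1
  rcases (abs_nonneg (inner ℝ h (ζ : E n))).eq_or_lt with ht | ht
  · rw [← ht, zero_mul, Real.zero_rpow (by linarith)]
  · rw [← Real.rpow_one_add' ht.le (by linarith)]
    ring_nf

/-- The map `extremal` is the Hölder equality case: `(q - 1)p = q` makes both its `p`-th moment and
its pairing with `⟨h, ζ⟩` equal to `alpha n q`. It is odd, so its Poisson integral vanishes at `0`.
-/
lemma le_of_mem_derivBounds {n : ℕ} (hn : 1 ≤ n) {p q : ℝ} (hpq : p.HolderConjugate q) {C : ℝ}
    (hC : C ∈ derivBounds n p) : 2 * ((n : ℝ) - 1) * alpha n q ^ (1 / q) ≤ C := by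
  have hn' : (0 : ℝ) ≤ n - 1 := by simpa using hn
  have hq : 1 < q := hpq.symm.lt
  have hα := alpha_pos hn hpq.symm.nonneg
  have hh := norm_lastVec hn
  have hmem := memLp_extremal hn hq hh (ENNReal.ofReal p)
  obtain ⟨φ, hφ⟩ : ∃ φ, φ = hmem.toLp := ⟨_, rfl⟩
  have hae : φ =ᵐ[sigma n] extremal n q (lastVec n) := hφ ▸ hmem.coeFn_toLp
  have hint := integrable_of_Lp hn hpq.lt.le φ
  have h0 : poisson n φ 0 = 0 := by
    rw [poisson_zero, integral_congr_ae hae]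
    refine integral_sigma_eq_zero_of_odd fun ζ ↦ ?_
    simp [extremal, Left.sign_neg]
  have hD : poissonDeriv n φ hint (lastVec n) =
      (2 * ((n : ℝ) - 1) * alpha n q) • lastVec n := by
    have : (fun ζ : S n ↦ inner ℝ (lastVec n) (ζ : E n) • φ ζ) =ᵐ[sigma n]
        fun ζ ↦ |inner ℝ (lastVec n) (ζ : E n)| ^ q • lastVec n := by
      filter_upwards [hae] with ζ hζ
      rw [hζ, inner_smul_extremal hq]
    rw [poissonDeriv_apply, integral_congr_ae this, integral_smul_const,
      integral_sigma_abs_inner_rpow hpq.symm.nonneg _ hh, smul_smul]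
  have hN : ‖φ‖ = alpha n q ^ (1 / p) := by
    have : (fun ζ ↦ ‖φ ζ‖ ^ p) =ᵐ[sigma n] fun ζ ↦ |inner ℝ (lastVec n) (ζ : E n)| ^ q := by
      filter_upwards [hae] with ζ hζ
      rw [hζ, norm_extremal hq hh, ← Real.rpow_mul (abs_nonneg _), hpq.symm.sub_one_mul_conj]
    rw [Lp_norm_eq_integral hpq.pos, integral_congr_ae this,
      integral_sigma_abs_inner_rpow hpq.symm.nonneg _ hh]
  have h1 := (hC φ h0).2
  rw [(hasFDerivAt_poisson hn hint).fderiv, hN] at h1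
  have h2 := (poissonDeriv n φ hint).le_opNorm (lastVec n)
  rw [hD, norm_smul, hh, mul_one, mul_one, Real.norm_of_nonneg (by positivity)] at h2
  have h3 : alpha n q = alpha n q ^ (1 / q) * alpha n q ^ (1 / p) := by
    rw [← Real.rpow_add hα, hpq.symm.one_div_add_one_div, div_one, Real.rpow_one]
  have h4 := h2.trans h1
  -- The first rewrite also expands the base of `alpha n q ^ (1 / p)` on the right; the last folds
  -- it back, so that this common factor cancels.
  rw [h3, ← mul_assoc, ← h3] at h4
  exact le_of_mul_le_mul_right h4 (by positivity)

end HypHarm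

theorem lemma2p8 (n : ℕ) (hn : 2 ≤ n) (p q : ℝ) (hp : 1 < p) (hpq : p.HolderConjugate q) :
    HasDerivWithinAt (HypHarm.G n p)
      (2 * ((n : ℝ) - 1) * HypHarm.alpha n q ^ (1 / q)) (Set.Ico 0 1) 0 ∧
    IsLeast (HypHarm.derivBounds n p)
      (2 * ((n : ℝ) - 1) * HypHarm.alpha n q ^ (1 / q)) := by
  have hn1 : 1 ≤ n := by omega
  refine ⟨HypHarm.hasDerivWithinAt_G hn1 hpq, fun φ _ ↦ ?_,
    fun C hC ↦ HypHarm.le_of_mem_derivBounds hn1 hpq hC⟩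
  have h := HypHarm.hasFDerivAt_poisson hn1 (HypHarm.integrable_of_Lp hn1 hp.le φ)
  exact ⟨h.differentiableAt, h.fderiv ▸ HypHarm.norm_poissonDeriv_le hn1 hpq φ _⟩
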